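/- **Setting.** Let $n\ge 0$, $\hbar>0$, $\varkappa\in\mathbb R$, and let $\mathbb S=\mathbb S(\mathbb R^n)$ be the complex Schwartz space. Put $\hat z=(-i\hbar\partial_{\vec x},\vec x)$, let $\hat w$ be the same operators in the variable $\vec y$, and $J=\begin{pmatrix}0&-\mathbb I\\ \mathbb I&0\end{pmatrix}$. Let $\mathcal H_{zz}(t),W_{zz}(t),W_{ww}(t)$ (symmetric) and $W_{zw}(t)$ be real $2n\times 2n$ matrices and $\mathcal H_z(t)\in\mathbb R^{2n}$, all continuous in $t\in\mathbb R$. The reduced Gross–Pitaevskii equation (RGPE) is $$\Big\{-i\hbar\partial_t+\tfrac12\langle\hat z,\mathcal H_{zz}\hat z\rangle+\langle\mathcal H_z,\hat z\rangle+\varkappa\int_{\mathbb R^n}d\vec y\,\Psi^*(\vec y,t)\big[\tfrac12\langle\hat z,W_{zz}\hat z\rangle+\langle\hat z,W_{zw}\hat w\rangle+\tfrac12\langle\hat w,W_{ww}\hat w\rangle\big]\Psi(\vec y,t)\Big\}\Psi(\vec x,t)=0 ,$$ where a solution is a $C^\infty$ curve $t\mapsto\Psi(\cdot,t)$, $t\in\mathbb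 R$, in $\mathbb S$. For $0\ne\psi\in\mathbb S$ let $\mathfrak g_\psi=(z_\psi,\Delta_\psi)$ be its moments: the normalized expectation values $\|\psi\|^{-2}(\psi,\cdot\,\psi)$ of $\hat z_k$ and of $\frac12(\Delta\hat z_k\Delta\hat z_l+\Delta\hat z_l\Delta\hat z_k)$, $\Delta\hat z=\hat z-z_\psi$. For a real parameter $\tilde\varkappa$ the Hamilton–Ehrenfest system is $$\dot z=J\{\mathcal H_z+[\mathcal H_{zz}+\tilde\varkappa(W_{zz}+W_{zw})]z\},\qquad \dot\Delta=J[\mathcal H_{zz}+\tilde\varkappa W_{zz}]\Delta-\Delta[\mathcal H_{zz}+\tilde\varkappa W_{zz}]J,\qquad \Delta=\Delta^{T}.$$ Fix an initial time $s\in\mathbb R$. A general solution is a family $\mathfrak g_{\tilde\varkappa}(t,\mathbf C)=(Z(t,\mathbf C),\Delta(t,\mathbf C))$ of solutions, $\mathbf C$ in a set of constants, such that every Cauchy datum at $t=s$ is attained for exactly one $\mathbf C$. The associated linear operator is $$\hat L_{\tilde\varkappa}(t,\mathbf C)=-i\hbar\partial_t+\tfrac12\langle\hat z,\mathcal H_{zz}\hat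 z\rangle+\langle\mathcal H_z,\hat z\rangle+\tfrac{\tilde\varkappa}2\langle\hat z,W_{zz}\hat z\rangle+\tilde\varkappa\langle\hat z,W_{zw}Z(t,\mathbf C)\rangle+\tfrac{\tilde\varkappa}2\langle Z(t,\mathbf C),W_{ww}Z(t,\mathbf C)\rangle+\tfrac{\tilde\varkappa}2\operatorname{Sp}[W_{ww}\Delta(t,\mathbf C)],$$ acting on the $C^\infty$ curves in $\mathbb S$. **Theorem 1.** Let $N,N'>0$, $\tilde\varkappa=\varkappa N$, $\tilde\varkappa'=\varkappa N'$, and let general solutions $\mathfrak g_{\tilde\varkappa}$, $\mathfrak g_{\tilde\varkappa'}$ (the same one if $\tilde\varkappa=\tilde\varkappa'$) with a common set of constants be given. For all $\mathbf C',\mathbf C$ and all $t$ let $\hat{\mathcal D}(t,s,\mathbf C',\mathbf C)$, $\hat B(t,\mathbf C)$ and $\hat a=\hat a(\mathbf C)$ be linear operators on $\mathbb S$ such that $\hat{\mathcal D}$ and $\hat B$ map $C^\infty$ curves in $\mathbb S$ to $C^\infty$ curves and, on these curves, $$\hat L_{\tilde\varkappa'}(t,\mathbf C')\hat{\mathcal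 D}(t,s,\mathbf C',\mathbf C)=\hat{\mathcal D}(t,s,\mathbf C',\mathbf C)\hat L_{\tilde\varkappa}(t,\mathbf C),\qquad \hat{\mathcal D}|_{t=s}=\hat{\mathbb I}$$ (the fundamental intertwining operator) and $$[\hat L_{\tilde\varkappa}(t,\mathbf C),\hat B(t,\mathbf C)]=0,\qquad \hat B(t,\mathbf C)|_{t=s}=\hat a$$ (a linear symmetry operator). Let $\Psi$ be a solution of the RGPE, $\psi=\Psi|_{t=s}$, with $\|\psi\|^2=N$ and $\|\hat a\psi\|^2=N'$, where $\hat a\psi:=\hat a(\mathbf C[\psi])\psi$. Then for every $t$ there is exactly one $\mathbf C=\mathbf C[\Psi](t)$ with $\mathfrak g_{\tilde\varkappa}(t,\mathbf C)=\mathfrak g_{\Psi}(t)$; it does not depend on $t$, i.e. $\mathbf C[\Psi](t)=\mathbf C[\Psi](s)=\mathbf C[\psi]$; there is exactly one $\mathbf C'=\mathbf C'[\hat a\psi]$ with $\mathfrak g_{\tilde\varkappa'}(s,\mathbf C')=\mathfrak g_{\hat a\psi}$; and $$(\hat A(t)\Psi)(\vec x,t)=\hat{\mathcal D}\big(t,s,\mathbf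 C'[\hat a\psi],\mathbf C[\Psi](t)\big)\,\hat B\big(t,\mathbf C[\Psi](t)\big)\Psi(\vec x,t)$$ is again a solution of the RGPE, with $\hat A(t)\Psi|_{t=s}=\hat a\psi$. That is, $\hat A$ is a nonlinear symmetry operator of the RGPE. -/

import Mathlib

open scoped SchwartzMap Matrix ComplexConjugate

namespace RGPE

/-! ### The Schwartz space and the operators `ẑ = (p̂, x)` -/

/-- The complex Schwartz space `𝕊` over `ℝⁿ`. -/
abbrev State (n : ℕ) : Type := 𝓢(EuclideanSpace ℝ (Fin n), ℂ)

/-- Index set of the `2n` components of `z = (p, x)`: `Sum.inl j` stands for the momentum `p_j`,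
`Sum.inr j` for the coordinate `x_j`. -/
abbrev PhaseIdx (n : ℕ) : Type := Fin n ⊕ Fin n

/-- The operators `ẑ = (-iħ ∂/∂x, x)` on the Schwartz space. -/
noncomputable def zOp {n : ℕ} (ħ : ℝ) : PhaseIdx n → (State n →L[ℂ] State n)
  | Sum.inl j => (-(Complex.I * (ħ : ℂ))) •
      LineDeriv.lineDerivOpCLM ℂ (State n) (EuclideanSpace.single j (1 : ℝ))
  | Sum.inr j => SchwartzMap.smulLeftCLM ℂ (fun x : EuclideanSpace ℝ (Fin n) => ((x j : ℝ) : ℂ))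

theorem zOp_inl_apply {n : ℕ} (ħ : ℝ) (j : Fin n) (φ : State n) (x : EuclideanSpace ℝ (Fin n)) :
    zOp ħ (Sum.inl j) φ x =
      -(Complex.I * (ħ : ℂ)) * lineDeriv ℝ φ x (EuclideanSpace.single j (1 : ℝ)) := by
  simp [zOp, SchwartzMap.lineDerivOp_apply]

theorem zOp_inr_apply {n : ℕ} (ħ : ℝ) (j : Fin n) (φ : State n) (x : EuclideanSpace ℝ (Fin n)) :
    zOp ħ (Sum.inr j) φ x = ((x j : ℝ) : ℂ) * φ x := by
  have h : Function.HasTemperateGrowth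
      (fun x : EuclideanSpace ℝ (Fin n) => ((x j : ℝ) : ℂ)) :=
    ((Complex.ofRealCLM).comp (EuclideanSpace.proj j : EuclideanSpace ℝ (Fin n) →L[ℝ] ℝ)
      ).hasTemperateGrowth
  simp only [zOp]
  rw [SchwartzMap.smulLeftCLM_apply_apply h, smul_eq_mul]

/-- `⟨ẑ, M ẑ⟩ = ∑ M_{kl} ẑ_k ẑ_l`. -/
noncomputable def quadOp {n : ℕ} (ħ : ℝ) (M : Matrix (PhaseIdx n) (PhaseIdx n) ℝ) :
    State n →L[ℂ] State n :=
  ∑ k, ∑ l, ((M k l : ℝ) : ℂ) • ((zOp ħ k) ∘L (zOp ħ l))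

/-- `⟨v, ẑ⟩ = ∑ v_k ẑ_k`. -/
noncomputable def linOp {n : ℕ} (ħ : ℝ) (v : PhaseIdx n → ℝ) : State n →L[ℂ] State n :=
  ∑ k, ((v k : ℝ) : ℂ) • zOp ħ k

/-! ### Mass, expectation values, moments -/

/-- The squared `L²` norm `‖ψ‖²`. -/
noncomputable def mass {n : ℕ} (ψ : State n) : ℝ := ∫ x, ‖ψ x‖ ^ 2

/-- The expectation value `‖ψ‖⁻² (ψ, Aψ)`; it is a real number for the symmetric operators
`A` to which it is applied. -/
noncomputable def expectation {n : ℕ} (A : State n →L[ℂ] State n) (ψ : State n) : ℝ :=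
  ((∫ x, conj (ψ x) * A ψ x) / ((mass ψ : ℝ) : ℂ)).re

/-- A point of the phase space of the Hamilton--Ehrenfest system: first moments `z` and
second centered moments `Δ`. -/
@[ext]
structure Moments (n : ℕ) where
  z : PhaseIdx n → ℝ
  Δ : Matrix (PhaseIdx n) (PhaseIdx n) ℝ

/-- The first moments `z_ψ`. -/
noncomputable def firstMoments {n : ℕ} (ħ : ℝ) (ψ : State n) : PhaseIdx n → ℝ :=
  fun k => expectation (zOp ħ k) ψ

/-- The operator `Δẑ_k = ẑ_k - a_k`. -/
noncomputable def centeredOp {n : ℕ} (ħ : ℝ) (a : PhaseIdx n → ℝ) (k : PhaseIdx n) :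
    State n →L[ℂ] State n :=
  zOp ħ k - ((a k : ℝ) : ℂ) • ContinuousLinearMap.id ℂ (State n)

/-- The moments `𝔤_ψ = (z_ψ, Δ_ψ)`; `Δ_ψ` consists of the expectation values of
`(Δẑ_k Δẑ_l + Δẑ_l Δẑ_k) / 2`, where `Δẑ = ẑ - z_ψ`. -/
noncomputable def moments {n : ℕ} (ħ : ℝ) (ψ : State n) : Moments n where
  z := firstMoments ħ ψ
  Δ := fun k l =>
    expectation
      ((1 / 2 : ℂ) •
        ((centeredOp ħ (firstMoments ħ ψ) k) ∘L (centeredOp ħ (firstMoments ħ ψ) l)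
          + (centeredOp ħ (firstMoments ħ ψ) l) ∘L (centeredOp ħ (firstMoments ħ ψ) k))) ψ

/-! ### The reduced Gross--Pitaevskii equation -/

/-- The data of a reduced Gross--Pitaevskii equation: Planck's constant, the nonlinearity
parameter `ϰ`, and the coefficients of
`H_qu = ⟨ẑ, H_zz ẑ⟩ / 2 + ⟨H_z, ẑ⟩` and
`V_qu = ⟨ẑ, W_zz ẑ⟩ / 2 + ⟨ẑ, W_zw ŵ⟩ + ⟨ŵ, W_ww ŵ⟩ / 2`.
The symmetry of the real matrices `H_zz`, `W_zz`, `W_ww` says that these operators are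
Weyl ordered and Hermitian. -/
structure Coeffs (n : ℕ) where
  ħ : ℝ
  ħ_pos : 0 < ħ
  κ : ℝ
  Hzz : ℝ → Matrix (PhaseIdx n) (PhaseIdx n) ℝ
  Hz : ℝ → PhaseIdx n → ℝ
  Wzz : ℝ → Matrix (PhaseIdx n) (PhaseIdx n) ℝ
  Wzw : ℝ → Matrix (PhaseIdx n) (PhaseIdx n) ℝ
  Www : ℝ → Matrix (PhaseIdx n) (PhaseIdx n) ℝ
  Hzz_symm : ∀ t, (Hzz t).IsSymm
  Wzz_symm : ∀ t, (Wzz t).IsSymm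
  Www_symm : ∀ t, (Www t).IsSymm
  Hzz_cont : Continuous Hzz
  Hz_cont : Continuous Hz
  Wzz_cont : Continuous Wzz
  Wzw_cont : Continuous Wzw
  Www_cont : Continuous Www

/-- Smooth dependence on time: a `C^∞` curve in the (Fréchet) Schwartz space. -/
def IsSmoothCurve {n : ℕ} (Ψ : ℝ → State n) : Prop :=
  ∀ j : ℕ, Differentiable ℝ (deriv^[j] Ψ)

/-- `H_qu(ẑ, t)`. -/
noncomputable def Hqu {n : ℕ} (P : Coeffs n) (t : ℝ) : State n →L[ℂ] State n :=
  (1 / 2 : ℂ) • quadOp P.ħ (P.Hzz t) + linOp P.ħ (P.Hz t)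

/-- `(V_qu(ẑ, ŵ, t) F)(x, y)` for `F(x, y) = φ(x) χ(y)`, where `ẑ` acts on the variable `x` and
`ŵ` acts on the variable `y`. -/
noncomputable def Vqu {n : ℕ} (P : Coeffs n) (t : ℝ) (φ χ : State n)
    (x y : EuclideanSpace ℝ (Fin n)) : ℂ :=
  (1 / 2 : ℂ) * (quadOp P.ħ (P.Wzz t) φ x * χ y)
    + ∑ k, ∑ l, ((P.Wzw t k l : ℝ) : ℂ) * (zOp P.ħ k φ x * zOp P.ħ l χ y)
    + (1 / 2 : ℂ) * (φ x * quadOp P.ħ (P.Www t) χ y)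

/-- `Ψ` is a solution of the reduced Gross--Pitaevskii equation
`{-iħ ∂_t + H_qu(ẑ, t) + ϰ ∫ dy Ψ^*(y, t) V_qu(ẑ, ŵ, t) Ψ(y, t)} Ψ(x, t) = 0`. -/
def IsSolution {n : ℕ} (P : Coeffs n) (Ψ : ℝ → State n) : Prop :=
  IsSmoothCurve Ψ ∧
  ∀ (t : ℝ) (x : EuclideanSpace ℝ (Fin n)),
    -(Complex.I * (P.ħ : ℂ)) * (deriv Ψ t) x + Hqu P t (Ψ t) x
      + (P.κ : ℂ) * ∫ y, conj (Ψ t y) * Vqu P t (Ψ t) (Ψ t) x y = 0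

/-! ### The Hamilton--Ehrenfest system and its general solution -/

/-- `m = (z, Δ)` solves the Hamilton--Ehrenfest system with the parameter `κt` (which is
`ϰ ‖Ψ‖²`):
`ż = J {H_z + [H_zz + κt (W_zz + W_zw)] z}`,
`Δ̇ = J [H_zz + κt W_zz] Δ - Δ [H_zz + κt W_zz] J`, with `Δ` symmetric. -/
def IsHESSolution {n : ℕ} (P : Coeffs n) (κt : ℝ) (m : ℝ → Moments n) : Prop :=
  ∀ t : ℝ,
    (m t).Δ.IsSymm ∧
    (∀ k, HasDerivAt (fun τ => (m τ).z k)
      ((Matrix.J (Fin n) ℝ *ᵥ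
        (P.Hz t + (P.Hzz t + κt • (P.Wzz t + P.Wzw t)) *ᵥ (m t).z)) k) t) ∧
    (∀ k l, HasDerivAt (fun τ => (m τ).Δ k l)
      ((Matrix.J (Fin n) ℝ * (P.Hzz t + κt • P.Wzz t) * (m t).Δ
        - (m t).Δ * (P.Hzz t + κt • P.Wzz t) * Matrix.J (Fin n) ℝ) k l) t)

/-- `g(t, C)` is the general solution of the Hamilton--Ehrenfest system, with the integration
constants `C`: all `g(·, C)` are solutions, and any Cauchy data at the initial time `s` are attained
for exactly one value of the constants. -/
def IsGeneralSolution {n : ℕ} {𝒞 : Type*} (P : Coeffs n) (κt s : ℝ) (g : ℝ → 𝒞 → Moments n) :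
    Prop :=
  (∀ C, IsHESSolution P κt (fun t => g t C)) ∧
  ∀ m : Moments n, m.Δ.IsSymm → ∃! C, g s C = m

/-- The integration constants `C` that are determined by the algebraic condition `g(t, C) = m`. -/
noncomputable def constants {n : ℕ} {𝒞 : Type*} [Nonempty 𝒞] (g : ℝ → 𝒞 → Moments n) (t : ℝ)
    (m : Moments n) : 𝒞 :=
  Classical.epsilon fun C => g t C = m

/-! ### The associated linear equation, intertwining and symmetry operators -/

/-- The operator `Ĥ_q(t)` of the associated linear equation, in which the phase orbit has the value
`m = (Z, Δ)` at the time `t`. -/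
noncomputable def Hq {n : ℕ} (P : Coeffs n) (κt t : ℝ) (m : Moments n) : State n →L[ℂ] State n :=
  (1 / 2 : ℂ) • quadOp P.ħ (P.Hzz t) + linOp P.ħ (P.Hz t)
    + ((κt / 2 : ℝ) : ℂ) • quadOp P.ħ (P.Wzz t)
    + ((κt : ℝ) : ℂ) • linOp P.ħ (P.Wzw t *ᵥ m.z)
    + ((κt / 2 * (m.z ⬝ᵥ (P.Www t *ᵥ m.z)) + κt / 2 * (P.Www t * m.Δ).trace : ℝ) : ℂ) •
        ContinuousLinearMap.id ℂ (State n)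

/-- The operator `L̂ = -iħ ∂_t + Ĥ_q` of the associated linear equation with the phase orbit `m`,
applied to the curve `Φ`, at time `t`. -/
noncomputable def L {n : ℕ} (P : Coeffs n) (κt : ℝ) (m : ℝ → Moments n) (Φ : ℝ → State n) (t : ℝ) :
    State n :=
  (-(Complex.I * (P.ħ : ℂ))) • deriv Φ t + Hq P κt t (m t) (Φ t)

/-- `T` intertwines: `L' T = T L` as operators on the smooth curves in the Schwartz space, where `L`
belongs to `(κt, m)` and `L'` belongs to `(κt', m')`. -/
def Intertwines {n : ℕ} (P : Coeffs n) (κt' : ℝ) (m' : ℝ → Moments n) (κt : ℝ) (m : ℝ → Moments n)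
    (T : ℝ → (State n →ₗ[ℂ] State n)) : Prop :=
  ∀ Φ : ℝ → State n, IsSmoothCurve Φ →
    IsSmoothCurve (fun t => T t (Φ t)) ∧
    ∀ t, L P κt' m' (fun τ => T τ (Φ τ)) t = T t (L P κt m Φ t)

/-- The fundamental intertwining operator: `L' D = D L` and `D = 1` at `t = s`. -/
def IsFundamentalIntertwining {n : ℕ} (P : Coeffs n) (s κt' : ℝ) (m' : ℝ → Moments n) (κt : ℝ)
    (m : ℝ → Moments n) (D : ℝ → (State n →ₗ[ℂ] State n)) : Prop :=
  Intertwines P κt' m' κt m D ∧ D s = LinearMap.id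

/-- `B` is a linear symmetry operator of the associated linear equation, `[L, B] = 0`, with
`B = a` at `t = s`. -/
def IsLinearSymmetry {n : ℕ} (P : Coeffs n) (s κt : ℝ) (m : ℝ → Moments n)
    (a : State n →ₗ[ℂ] State n) (B : ℝ → (State n →ₗ[ℂ] State n)) : Prop :=
  Intertwines P κt m κt m B ∧ B s = a

/-! ### The nonlinear operator -/

/-- `C[Ψ](t)`, determined by `g(t, C[Ψ](t)) = 𝔤_Ψ(t)`. -/
noncomputable def constantsOf {n : ℕ} {𝒞 : Type*} [Nonempty 𝒞] (P : Coeffs n)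
    (g : ℝ → 𝒞 → Moments n) (Ψ : ℝ → State n) (t : ℝ) : 𝒞 :=
  constants g t (moments P.ħ (Ψ t))

/-- The function `âψ`, where `ψ = Ψ(s)`; the linear operator `â` may depend on the constants
`C = C[ψ]`. -/
noncomputable def initialImage {n : ℕ} {𝒞 : Type*} [Nonempty 𝒞] (P : Coeffs n) (s : ℝ)
    (g : ℝ → 𝒞 → Moments n) (a : 𝒞 → (State n →ₗ[ℂ] State n)) (Ψ : ℝ → State n) : State n :=
  a (constantsOf P g Ψ s) (Ψ s)

/-- `(AΨ)(t) = D(t, s, C'[âψ], C[Ψ](t)) B(t, C[Ψ](t)) Ψ(t)`, where `g` is used to determine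
`C[Ψ](t)` and `g'` is used to determine `C'[âψ]`. -/
noncomputable def nonlinearSymmetry {n : ℕ} {𝒞 : Type*} [Nonempty 𝒞] (P : Coeffs n) (s : ℝ)
    (g' g : ℝ → 𝒞 → Moments n) (D : ℝ → 𝒞 → 𝒞 → (State n →ₗ[ℂ] State n))
    (a : 𝒞 → (State n →ₗ[ℂ] State n)) (B : ℝ → 𝒞 → (State n →ₗ[ℂ] State n))
    (Ψ : ℝ → State n) (t : ℝ) : State n :=
  D t (constants g' s (moments P.ħ (initialImage P s g a Ψ))) (constantsOf P g Ψ t)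
    (B t (constantsOf P g Ψ t) (Ψ t))

end RGPE

/-! The nonlocal term sees the state only through its mass and its first and second moments. Hence a
curve solves the RGPE iff it solves the linear equation built from its own mass and moments
(`isSolution_iff`). That equation has a symmetric Hamiltonian quadratic in `ẑ`. Symmetry conserves
the mass, which makes the parameter `ϰ‖Ψ‖²` constant. Quadraticity makes commutators with `ẑ` affine
in `ẑ`, so the moments obey closed linear ODEs (`hasDerivAt_moments_z`, `hasDerivAt_moments_Δ`).

Uniqueness for these ODEs is used twice. The moments of `Ψ` solve the Hamilton–Ehrenfest system
(`isHESSolution_moments`), so they follow a single orbit and the constants are conserved.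
Conversely, a solution of the linear equation along an orbit that has the orbit's moments at one
time has them always (`moments_eq_of_L_eq_zero`).

So `Ψ` lies in the kernel of `L` for its orbit, `B` preserves this kernel, and `D` carries it into
the kernel of the operator for the orbit `C'`. At `t = s` the image is `âψ`, whose mass and moments
are by choice those of the target equation. They stay so for all times, and the linear equation is
again the RGPE. -/

namespace RGPE

/-! ### The `L²` pairing and symmetric operators -/

open MeasureTheory

/-- The `L²` pairing `(φ, χ)`, antilinear in `φ`. -/
noncomputable def pairing {n : ℕ} (φ χ : State n) : ℂ := ∫ x, conj (φ x) * χ x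

/-- The embedding of the Schwartz space into `L²`. -/
noncomputable def toL2 {n : ℕ} :
    State n →L[ℂ] Lp ℂ 2 (volume : Measure (EuclideanSpace ℝ (Fin n))) :=
  SchwartzMap.toLpCLM ℂ ℂ 2 volume

theorem pairing_eq_inner {n : ℕ} (φ χ : State n) : pairing φ χ = inner ℂ (toL2 φ) (toL2 χ) := by
  simp [toL2, pairing, mul_comm]

theorem pairing_add_right {n : ℕ} (φ χ₁ χ₂ : State n) :
    pairing φ (χ₁ + χ₂) = pairing φ χ₁ + pairing φ χ₂ := by
  simp only [pairing_eq_inner, map_add, inner_add_right]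

theorem pairing_smul_right {n : ℕ} (c : ℂ) (φ χ : State n) :
    pairing φ (c • χ) = c * pairing φ χ := by
  simp only [pairing_eq_inner, map_smul, inner_smul_right]

theorem pairing_add_left {n : ℕ} (φ₁ φ₂ χ : State n) :
    pairing (φ₁ + φ₂) χ = pairing φ₁ χ + pairing φ₂ χ := by
  simp only [pairing_eq_inner, map_add, inner_add_left]

theorem pairing_smul_left {n : ℕ} (c : ℂ) (φ χ : State n) :
    pairing (c • φ) χ = conj c * pairing φ χ := by
  simp only [pairing_eq_inner, map_smul, inner_smul_left]

theorem conj_pairing {n : ℕ} (φ χ : State n) : conj (pairing φ χ) = pairing χ φ := by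
  simp only [pairing_eq_inner, inner_conj_symm]

theorem pairing_self {n : ℕ} (φ : State n) : pairing φ φ = (mass φ : ℂ) := by
  rw [pairing, mass, ← integral_complex_ofReal]
  congr 1
  ext x
  rw [mul_comm, Complex.mul_conj, Complex.normSq_eq_norm_sq]

/-- A continuous function vanishing almost everywhere vanishes. This settles the degenerate case in
which `expectation` divides by zero. -/
theorem eq_zero_of_mass_eq_zero {n : ℕ} {φ : State n} (h : mass φ = 0) : φ = 0 := by
  have h1 : ∫ x, ‖φ x‖ ^ 2 = 0 := h
  have hc : Continuous fun x => ‖φ x‖ ^ 2 := φ.continuous.norm.pow 2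
  have hi : Integrable fun x => ‖φ x‖ ^ 2 := (φ.memLp 2 volume).integrable_norm_pow (by norm_num)
  rw [integral_eq_zero_iff_of_nonneg (fun x => by positivity) hi] at h1
  have h2 := (hc.ae_eq_iff_eq volume continuous_const).1 h1
  ext x
  exact norm_eq_zero.1 (pow_eq_zero_iff two_ne_zero |>.1 (congrFun h2 x))

/-- An operator on the Schwartz space that is symmetric for the `L²` pairing. -/
def IsSymmetricOp {n : ℕ} (A : State n →L[ℂ] State n) : Prop :=
  ∀ φ χ, pairing φ (A χ) = pairing (A φ) χ

theorem isSymmetricOp_zOp {n : ℕ} (ħ : ℝ) (k : PhaseIdx n) :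
    IsSymmetricOp (zOp (n := n) ħ k) := by
  intro φ χ
  rcases k with j | j
  -- Integration by parts for the real-bilinear map `(a, b) ↦ conj a * b`; its sign cancels against
  -- the conjugation of `I`.
  · have h := SchwartzMap.integral_bilinear_lineDerivOp_right_eq_neg_left (μ := volume) φ χ
      ((ContinuousLinearMap.mul ℝ ℂ).comp (Complex.conjCLE : ℂ →L[ℝ] ℂ))
      (EuclideanSpace.single j (1 : ℝ))
    simp only [zOp, smul_apply, pairing_smul_left, pairing_smul_right,
      LineDeriv.lineDerivOpCLM_apply]
    simp only [ContinuousLinearMap.comp_apply, ContinuousLinearMap.mul_apply',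
      ContinuousLinearEquiv.coe_coe, Complex.conjCLE_apply] at h
    rw [pairing, h, pairing]
    simp
  · rw [pairing, pairing]
    congr 1
    ext x
    simp only [zOp_inr_apply, map_mul, Complex.conj_ofReal]
    ring

namespace IsSymmetricOp

variable {n : ℕ} {A A' : State n →L[ℂ] State n}

theorem add (hA : IsSymmetricOp A) (hA' : IsSymmetricOp A') : IsSymmetricOp (A + A') := by
  intro φ χ
  simp only [add_apply, pairing_add_left, pairing_add_right, hA φ χ, hA' φ χ]

theorem smul (hA : IsSymmetricOp A) (c : ℝ) : IsSymmetricOp ((c : ℂ) • A) := by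
  intro φ χ
  simp only [smul_apply, pairing_smul_left, pairing_smul_right, hA φ χ,
    Complex.conj_ofReal]

theorem zero : IsSymmetricOp (0 : State n →L[ℂ] State n) := by
  intro φ χ
  simp [pairing]

theorem id : IsSymmetricOp (ContinuousLinearMap.id ℂ (State n)) := fun _ _ => rfl

theorem sum {ι : Type*} (S : Finset ι) {F : ι → State n →L[ℂ] State n}
    (hF : ∀ i, IsSymmetricOp (F i)) : IsSymmetricOp (∑ i ∈ S, F i) :=
  Finset.sum_induction F IsSymmetricOp (fun _ _ h h' => h.add h') zero fun i _ => hF i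

end IsSymmetricOp

theorem isSymmetricOp_linOp {n : ℕ} (ħ : ℝ) (v : PhaseIdx n → ℝ) :
    IsSymmetricOp (linOp ħ v) :=
  IsSymmetricOp.sum _ fun k => (isSymmetricOp_zOp ħ k).smul _

/-- The symmetrized product `(A B + B A) / 2`. -/
noncomputable def symProd {n : ℕ} (A B : State n →L[ℂ] State n) : State n →L[ℂ] State n :=
  (1 / 2 : ℂ) • (A * B + B * A)

/-- Transposing the indices exchanges the two operator orders, so a symmetric `M` sees only their
average. Symmetrized products are what the second moments measure. -/
theorem quadOp_eq_sum_symProd {n : ℕ} (ħ : ℝ) {M : Matrix (PhaseIdx n) (PhaseIdx n) ℝ}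
    (hM : M.IsSymm) :
    quadOp ħ M = ∑ k, ∑ l, ((M k l : ℝ) : ℂ) • symProd (zOp (n := n) ħ k) (zOp ħ l) := by
  have h2 : ∑ k, ∑ l, ((M k l : ℝ) : ℂ) • (zOp (n := n) ħ l * zOp ħ k) = quadOp ħ M := by
    rw [Finset.sum_comm, quadOp]
    refine Finset.sum_congr rfl fun k _ => Finset.sum_congr rfl fun l _ => ?_
    rw [hM.apply, ContinuousLinearMap.mul_def]
  simp only [symProd, smul_add, Finset.sum_add_distrib, smul_comm _ (1 / 2 : ℂ),
    ← Finset.smul_sum, h2]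
  simp only [ContinuousLinearMap.mul_def]
  rw [← quadOp, ← two_smul ℂ, smul_smul]
  simp

theorem IsSymmetricOp.symProd {n : ℕ} {A B : State n →L[ℂ] State n} (hA : IsSymmetricOp A)
    (hB : IsSymmetricOp B) : IsSymmetricOp (symProd A B) := by
  intro φ χ
  simp only [RGPE.symProd, smul_apply, add_apply, mul_apply_eq_comp, pairing_smul_right,
    pairing_smul_left, pairing_add_left, pairing_add_right, hA φ, hB φ, hA _ χ, hB _ χ]
  rw [add_comm, map_div₀, map_one, Complex.conj_ofNat]

theorem isSymmetricOp_quadOp {n : ℕ} (ħ : ℝ) {M : Matrix (PhaseIdx n) (PhaseIdx n) ℝ}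
    (hM : M.IsSymm) : IsSymmetricOp (quadOp ħ M) := by
  rw [quadOp_eq_sum_symProd ħ hM]
  exact IsSymmetricOp.sum _ fun k => IsSymmetricOp.sum _ fun l =>
    ((isSymmetricOp_zOp ħ k).symProd (isSymmetricOp_zOp ħ l)).smul _

theorem isSymmetricOp_Hq {n : ℕ} (P : Coeffs n) (κt t : ℝ) (m : Moments n) :
    IsSymmetricOp (Hq P κt t m) := by
  have h : (1 / 2 : ℂ) = (((1 / 2 : ℝ) : ℝ) : ℂ) := by simp
  rw [Hq, h]
  exact (((((isSymmetricOp_quadOp _ (P.Hzz_symm t)).smul _).add (isSymmetricOp_linOp _ _)).add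
    ((isSymmetricOp_quadOp _ (P.Wzz_symm t)).smul _)).add
    ((isSymmetricOp_linOp _ _).smul _)).add (IsSymmetricOp.id.smul _)

/-! ### Differentiating curves in the Schwartz space -/

/-- Stated for topological vector spaces because the Schwartz space is not normed. A continuous
linear map preserves the little-o remainder. -/
theorem _root_.ContinuousLinearMap.hasDerivAt_comp_curve {E F : Type*} [AddCommGroup E] [Module ℝ E]
    [TopologicalSpace E] [ContinuousSMul ℝ E] [AddCommGroup F] [Module ℝ F] [TopologicalSpace F]
    [ContinuousSMul ℝ F] (T : E →L[ℝ] F) {f : ℝ → E} {f' : E} {t : ℝ}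
    (h : HasDerivAt f f' t) : HasDerivAt (fun τ => T (f τ)) (T f') t := by
  rw [hasDerivAt_iff_hasFDerivAt, hasFDerivAt_iff_isLittleOTVS] at h ⊢
  refine ((T.isBigOTVS_fun_comp).trans_isLittleOTVS h).congr_left fun x => ?_
  simp

theorem _root_.DifferentiableAt.hasDerivAt_curve {E : Type*} [AddCommGroup E] [Module ℝ E]
    [TopologicalSpace E] [ContinuousSMul ℝ E] {f : ℝ → E} {t : ℝ} (h : DifferentiableAt ℝ f t) :
    HasDerivAt f (deriv f t) t := by
  have e : ContinuousLinearMap.toSpanSingleton ℝ (deriv f t) = fderiv ℝ f t :=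
    ContinuousLinearMap.ext_ring (by rw [ContinuousLinearMap.toSpanSingleton_apply, one_smul]; rfl)
  rw [hasDerivAt_iff_hasFDerivAt, e]
  exact h.hasFDerivAt

theorem hasDerivAt_pairing {n : ℕ} (A : State n →L[ℂ] State n) {Φ : ℝ → State n} {Φ' : State n}
    {t : ℝ} (h : HasDerivAt Φ Φ' t) :
    HasDerivAt (fun τ => pairing (Φ τ) (A (Φ τ)))
      (pairing (Φ t) (A Φ') + pairing Φ' (A (Φ t))) t := by
  -- Both factors are pushed into the Hilbert space `L²`, where the product rule for the inner
  -- product applies.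
  have h1 := (toL2.restrictScalars ℝ).hasDerivAt_comp_curve h
  have h2 := ((toL2 ∘L A).restrictScalars ℝ).hasDerivAt_comp_curve h
  have h3 := h1.inner ℂ h2
  simp only [pairing_eq_inner]
  exact h3


/-! ### Commutation relations and the Heisenberg derivation -/

theorem lineDerivOp_comm {n : ℕ} (v w : EuclideanSpace ℝ (Fin n)) (φ : State n) :
    LineDeriv.lineDerivOp v (LineDeriv.lineDerivOp w φ) =
      LineDeriv.lineDerivOp w (LineDeriv.lineDerivOp v φ) := by
  have key : ∀ (u : EuclideanSpace ℝ (Fin n)), (⇑(LineDeriv.lineDerivOp u φ) :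
      EuclideanSpace ℝ (Fin n) → ℂ) = fun y => fderiv ℝ φ y u := by
    intro u
    ext y
    exact SchwartzMap.lineDerivOp_apply_eq_fderiv u φ y
  ext x
  have hd : DifferentiableAt ℝ (fderiv ℝ φ) x :=
    ((φ.smooth 2).fderiv_right (m := 1) (by norm_num)).differentiable (by norm_num) x
  have hs : IsSymmSndFDerivAt ℝ φ x :=
    (φ.smooth 2).contDiffAt.isSymmSndFDerivAt (by simp)
  rw [SchwartzMap.lineDerivOp_apply_eq_fderiv, SchwartzMap.lineDerivOp_apply_eq_fderiv, key, key,
    fderiv_clm_apply hd (differentiableAt_const _), fderiv_clm_apply hd (differentiableAt_const _)]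
  simpa using hs v w

theorem zOp_inl_inr_apply {n : ℕ} (ħ : ℝ) (i j : Fin n) (φ : State n) :
    zOp ħ (Sum.inl i) (zOp ħ (Sum.inr j) φ) =
      zOp ħ (Sum.inr j) (zOp ħ (Sum.inl i) φ) -
        (if i = j then Complex.I * (ħ : ℂ) else 0) • φ := by
  ext x
  have hf : (⇑(zOp ħ (Sum.inr j) φ) : EuclideanSpace ℝ (Fin n) → ℂ) =
      fun y => ((y j : ℝ) : ℂ) * φ y := by
    ext y
    exact zOp_inr_apply ħ j φ y
  have h1 : HasFDerivAt (fun y : EuclideanSpace ℝ (Fin n) => ((y j : ℝ) : ℂ))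
      ((Complex.ofRealCLM).comp (EuclideanSpace.proj j : EuclideanSpace ℝ (Fin n) →L[ℝ] ℝ)) x :=
    ((Complex.ofRealCLM).comp
      (EuclideanSpace.proj j : EuclideanSpace ℝ (Fin n) →L[ℝ] ℝ)).hasFDerivAt
  have h2 := ((h1.mul (φ.hasFDerivAt x)).hasLineDerivAt (EuclideanSpace.single i (1 : ℝ))).lineDeriv
  have h3 : lineDeriv ℝ φ x (EuclideanSpace.single i (1 : ℝ)) =
      fderiv ℝ φ x (EuclideanSpace.single i (1 : ℝ)) :=
    ((φ.hasFDerivAt x).hasLineDerivAt _).lineDeriv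
  rw [sub_apply, zOp_inl_apply, zOp_inr_apply, zOp_inl_apply, hf]
  change lineDeriv ℝ (fun y => ((y j : ℝ) : ℂ) * φ y) x _ = _ at h2
  rw [h2, h3]
  rcases eq_or_ne i j with rfl | hij
  · simp
    ring
  · simp [hij, hij.symm]
    ring

/-- Momenta commute by symmetry of second derivatives, coordinates trivially; the mixed blocks come
from the product rule. -/
theorem zOp_commutator {n : ℕ} (ħ : ℝ) (k l : PhaseIdx n) :
    zOp ħ k * zOp ħ l - zOp ħ l * zOp ħ k =
      (Complex.I * (ħ : ℂ) * ((Matrix.J (Fin n) ℝ k l : ℝ) : ℂ)) •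
        (1 : State n →L[ℂ] State n) := by
  ext1 φ
  rw [sub_apply, mul_apply_eq_comp, mul_apply_eq_comp, smul_apply,
    one_apply_eq_self]
  rcases k with i | i <;> rcases l with j | j
  · simp only [zOp, smul_apply, map_smul, LineDeriv.lineDerivOpCLM_apply,
      lineDerivOp_comm (EuclideanSpace.single i (1 : ℝ))]
    simp [Matrix.J]
  · rw [zOp_inl_inr_apply]
    by_cases hij : i = j <;> simp [Matrix.J, hij]
  · rw [zOp_inl_inr_apply]
    by_cases hij : i = j <;> simp [Matrix.J, hij, eq_comm]
  · ext x
    simp [Matrix.J, zOp_inr_apply]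
    ring

/-- The Heisenberg derivation `A ↦ (i / ħ) [H, A]`. -/
noncomputable def heisenberg {n : ℕ} (ħ : ℝ) (H A : State n →L[ℂ] State n) :
    State n →L[ℂ] State n :=
  (Complex.I / (ħ : ℂ)) • (H * A - A * H)

/-- The Leibniz rule splits `[ẑ_a ẑ_b, ẑ_k]` into two linear terms, which the symmetry of `M` makes
equal after summation. The resulting 2 cancels the 1/2 in the Hamiltonian. -/
theorem quadOp_commutator {n : ℕ} (ħ : ℝ) {M : Matrix (PhaseIdx n) (PhaseIdx n) ℝ}
    (hM : M.IsSymm) (k : PhaseIdx n) :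
    quadOp ħ M * zOp ħ k - zOp ħ k * quadOp ħ M =
      (-2 * (Complex.I * (ħ : ℂ))) • linOp ħ ((Matrix.J (Fin n) ℝ * M).row k) := by
  have hJ : ∀ a b, Matrix.J (Fin n) ℝ b a = -Matrix.J (Fin n) ℝ a b := fun a b => by
    simpa using congrFun (congrFun (Matrix.J_transpose (Fin n) ℝ) a) b
  set c : ℂ := Complex.I * (ħ : ℂ) with hc
  have h1 : ∀ a b, (zOp ħ a * zOp ħ b) * zOp ħ k - zOp ħ k * (zOp ħ a * zOp ħ b) =
      (-(c * ((Matrix.J (Fin n) ℝ k b : ℝ) : ℂ))) • zOp (n := n) ħ a +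
        (-(c * ((Matrix.J (Fin n) ℝ k a : ℝ) : ℂ))) • zOp ħ b := by
    intro a b
    have e1 := zOp_commutator (n := n) ħ b k
    have e2 := zOp_commutator (n := n) ħ a k
    rw [hJ k b] at e1
    rw [hJ k a] at e2
    calc _ = zOp ħ a * (zOp ħ b * zOp ħ k - zOp ħ k * zOp ħ b) +
          (zOp ħ a * zOp ħ k - zOp ħ k * zOp ħ a) * zOp ħ b := by noncomm_ring
      _ = _ := by
        rw [e1, e2]
        simp [hc]
  have h2 : quadOp ħ M * zOp ħ k - zOp ħ k * quadOp ħ M =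
      ∑ a, ∑ b, ((M a b : ℝ) : ℂ) • ((zOp ħ a * zOp ħ b) * zOp (n := n) ħ k -
        zOp ħ k * (zOp ħ a * zOp ħ b)) := by
    simp only [quadOp, Finset.sum_mul, Finset.mul_sum, ← Finset.sum_sub_distrib, smul_sub,
      smul_mul_assoc, mul_smul_comm, ContinuousLinearMap.mul_def]
  have h3 : ∀ f : PhaseIdx n → PhaseIdx n → (State n →L[ℂ] State n),
      ∑ a, ∑ b, ((M a b : ℝ) : ℂ) • f b a = ∑ a, ∑ b, ((M a b : ℝ) : ℂ) • f a b := by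
    intro f
    rw [Finset.sum_comm]
    refine Finset.sum_congr rfl fun a _ => Finset.sum_congr rfl fun b _ => ?_
    rw [hM.apply]
  rw [h2]
  simp only [h1, smul_add, Finset.sum_add_distrib]
  rw [h3 fun a b => (-(c * ((Matrix.J (Fin n) ℝ k b : ℝ) : ℂ))) • zOp ħ a, ← two_smul ℂ]
  rw [linOp, Finset.smul_sum, Finset.smul_sum]
  refine Finset.sum_congr rfl fun a _ => ?_
  simp only [smul_smul, ← Finset.sum_smul]
  congr 1
  simp only [Matrix.row_apply, Matrix.mul_apply]
  push_cast
  rw [Finset.mul_sum, Finset.mul_sum]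
  refine Finset.sum_congr rfl fun b _ => ?_
  rw [hM.apply]
  ring

theorem linOp_commutator {n : ℕ} (ħ : ℝ) (b : PhaseIdx n → ℝ) (k : PhaseIdx n) :
    linOp ħ b * zOp ħ k - zOp ħ k * linOp ħ b =
      (-(Complex.I * (ħ : ℂ)) * (((Matrix.J (Fin n) ℝ *ᵥ b) k : ℝ) : ℂ)) •
        (1 : State n →L[ℂ] State n) := by
  have hJ : ∀ a b, Matrix.J (Fin n) ℝ b a = -Matrix.J (Fin n) ℝ a b := fun a b => by
    simpa using congrFun (congrFun (Matrix.J_transpose (Fin n) ℝ) a) b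
  have h2 : linOp ħ b * zOp ħ k - zOp ħ k * linOp ħ b =
      ∑ a, ((b a : ℝ) : ℂ) • (zOp ħ a * zOp (n := n) ħ k - zOp ħ k * zOp ħ a) := by
    simp only [linOp, Finset.sum_mul, Finset.mul_sum, ← Finset.sum_sub_distrib, smul_sub,
      smul_mul_assoc, mul_smul_comm]
  rw [h2]
  simp only [zOp_commutator, smul_smul, ← Finset.sum_smul, Matrix.mulVec, dotProduct]
  congr 1
  push_cast
  rw [Finset.mul_sum]
  refine Finset.sum_congr rfl fun a _ => ?_
  rw [hJ k a]
  push_cast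
  ring

/-- This is why the moment equations close: the derivation sends `ẑ` to an affine function of `ẑ`.
The scalar `c` drops out, so `W_ww` never influences the moments. -/
theorem heisenberg_zOp {n : ℕ} {ħ : ℝ} (hħ : ħ ≠ 0) {M : Matrix (PhaseIdx n) (PhaseIdx n) ℝ}
    (hM : M.IsSymm) (b : PhaseIdx n → ℝ) (c : ℂ) (k : PhaseIdx n) :
    heisenberg ħ ((1 / 2 : ℂ) • quadOp ħ M + linOp ħ b + c • 1) (zOp ħ k) =
      linOp ħ ((Matrix.J (Fin n) ℝ * M).row k) +
        (((Matrix.J (Fin n) ℝ *ᵥ b) k : ℝ) : ℂ) • (1 : State n →L[ℂ] State n) := by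
  have h : ((1 / 2 : ℂ) • quadOp ħ M + linOp ħ b + c • 1) * zOp ħ k -
      zOp ħ k * ((1 / 2 : ℂ) • quadOp ħ M + linOp ħ b + c • 1) =
      (1 / 2 : ℂ) • (quadOp ħ M * zOp ħ k - zOp (n := n) ħ k * quadOp ħ M) +
        (linOp ħ b * zOp ħ k - zOp ħ k * linOp ħ b) := by
    simp only [add_mul, mul_add, smul_mul_assoc, mul_smul_comm, one_mul, mul_one, smul_sub]
    abel
  have hc : (ħ : ℂ) ≠ 0 := Complex.ofReal_ne_zero.2 hħ
  have hI : Complex.I / (ħ : ℂ) * -(Complex.I * (ħ : ℂ)) = 1 := by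
    field_simp
    simp
  rw [heisenberg, h, quadOp_commutator ħ hM, linOp_commutator, smul_add, smul_smul, smul_smul,
    smul_smul]
  congr 1
  · rw [show Complex.I / (ħ : ℂ) * (1 / 2) * (-2 * (Complex.I * (ħ : ℂ))) = 1 by
      linear_combination hI, one_smul]
  · rw [← mul_assoc, hI, one_mul]

theorem heisenberg_symProd {n : ℕ} (ħ : ℝ) (H A B : State n →L[ℂ] State n) :
    heisenberg ħ H (symProd A B) =
      symProd (heisenberg ħ H A) B + symProd A (heisenberg ħ H B) := by
  simp only [heisenberg, symProd, smul_mul_assoc, mul_smul_comm, ← smul_add, ← smul_sub]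
  rw [smul_comm (1 / 2 : ℂ) (Complex.I / (ħ : ℂ))]
  congr 2
  noncomm_ring

theorem symProd_add_left {n : ℕ} (A A' B : State n →L[ℂ] State n) :
    symProd (A + A') B = symProd A B + symProd A' B := by
  simp only [symProd, ← smul_add]
  congr 1
  noncomm_ring

theorem symProd_smul_left {n : ℕ} (c : ℂ) (A B : State n →L[ℂ] State n) :
    symProd (c • A) B = c • symProd A B := by
  simp only [symProd, smul_mul_assoc, mul_smul_comm, ← smul_add]
  rw [smul_comm]

theorem symProd_comm {n : ℕ} (A B : State n →L[ℂ] State n) : symProd A B = symProd B A := by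
  rw [symProd, symProd, add_comm]

theorem symProd_one_left {n : ℕ} (B : State n →L[ℂ] State n) : symProd 1 B = B := by
  rw [symProd, one_mul, mul_one, ← two_smul ℂ, smul_smul]
  simp

theorem symProd_linOp_left {n : ℕ} (ħ : ℝ) (v : PhaseIdx n → ℝ) (B : State n →L[ℂ] State n) :
    symProd (linOp ħ v) B = ∑ a, ((v a : ℝ) : ℂ) • symProd (zOp ħ a) B := by
  simp only [symProd, linOp, Finset.sum_mul, Finset.mul_sum, smul_mul_assoc, mul_smul_comm,
    ← Finset.sum_add_distrib, Finset.smul_sum, smul_add]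
  refine Finset.sum_congr rfl fun a _ => ?_
  rw [smul_comm (1 / 2 : ℂ), smul_comm (1 / 2 : ℂ)]


/-! ### Expectation values and Ehrenfest's theorem -/

theorem expectation_eq {n : ℕ} (A : State n →L[ℂ] State n) (ψ : State n) :
    expectation A ψ = (pairing ψ (A ψ)).re / mass ψ := by
  rw [expectation, ← pairing, Complex.div_ofReal_re]

theorem expectation_add {n : ℕ} (A B : State n →L[ℂ] State n) (ψ : State n) :
    expectation (A + B) ψ = expectation A ψ + expectation B ψ := by
  simp only [expectation_eq, add_apply, pairing_add_right, Complex.add_re, add_div]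

theorem expectation_smul {n : ℕ} (c : ℝ) (A : State n →L[ℂ] State n) (ψ : State n) :
    expectation ((c : ℂ) • A) ψ = c * expectation A ψ := by
  simp only [expectation_eq, smul_apply, pairing_smul_right, Complex.re_ofReal_mul, mul_div_assoc]

theorem expectation_sum {n : ℕ} {ι : Type*} (S : Finset ι) (F : ι → State n →L[ℂ] State n)
    (ψ : State n) : expectation (∑ i ∈ S, F i) ψ = ∑ i ∈ S, expectation (F i) ψ := by
  classical
  induction S using Finset.induction_on with
  | empty => simp [expectation]
  | insert i S hi ih => rw [Finset.sum_insert hi, Finset.sum_insert hi, expectation_add, ih]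

theorem expectation_one {n : ℕ} {ψ : State n} (h : mass ψ ≠ 0) :
    expectation (1 : State n →L[ℂ] State n) ψ = 1 := by
  rw [expectation_eq, one_apply_eq_self, pairing_self, Complex.ofReal_re, div_self h]

theorem expectation_linOp {n : ℕ} (ħ : ℝ) (v : PhaseIdx n → ℝ) (ψ : State n) :
    expectation (linOp ħ v) ψ = v ⬝ᵥ firstMoments ħ ψ := by
  simp only [linOp, expectation_sum, expectation_smul, dotProduct, firstMoments]

/-- Symmetry makes the pairing real, so the real part in `expectation` loses nothing; for zero mass
both sides vanish. -/
theorem pairing_eq_of_isSymmetricOp {n : ℕ} {A : State n →L[ℂ] State n} (hA : IsSymmetricOp A)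
    (ψ : State n) : pairing ψ (A ψ) = ((mass ψ * expectation A ψ : ℝ) : ℂ) := by
  have hre : (((pairing ψ (A ψ)).re : ℝ) : ℂ) = pairing ψ (A ψ) := by
    rw [← Complex.conj_eq_iff_re, conj_pairing, hA ψ ψ]
  rcases eq_or_ne (mass ψ) 0 with h | h
  · rw [eq_zero_of_mass_eq_zero h]
    simp [pairing, mass]
  · rw [expectation_eq, mul_div_cancel₀ _ h, hre]

/-- Ehrenfest's theorem for the unnormalized expectation values. -/
theorem hasDerivAt_pairing_of_schroedinger {n : ℕ} {ħ : ℝ} (hħ : ħ ≠ 0)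
    {H : State n →L[ℂ] State n} (hH : IsSymmetricOp H) {Φ : ℝ → State n} {Φ' : State n} {t : ℝ}
    (hΦ : HasDerivAt Φ Φ' t) (hS : (-(Complex.I * (ħ : ℂ))) • Φ' + H (Φ t) = 0)
    (A : State n →L[ℂ] State n) :
    HasDerivAt (fun τ => pairing (Φ τ) (A (Φ τ))) (pairing (Φ t) (heisenberg ħ H A (Φ t))) t := by
  have hc : (ħ : ℂ) ≠ 0 := Complex.ofReal_ne_zero.2 hħ
  have h' : Φ' = (-(Complex.I / (ħ : ℂ))) • H (Φ t) := by
    rw [eq_neg_of_add_eq_zero_right hS, ← neg_smul, smul_smul]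
    rw [show -(Complex.I / (ħ : ℂ)) * -(-(Complex.I * (ħ : ℂ))) = 1 by
      field_simp
      simp, one_smul]
  refine (hasDerivAt_pairing A hΦ).congr_deriv ?_
  rw [h', heisenberg, map_smul, pairing_smul_right, pairing_smul_left, ← hH, smul_apply,
    pairing_smul_right, sub_apply, mul_apply_eq_comp, mul_apply_eq_comp, sub_eq_add_neg,
    ← neg_one_smul ℂ (A (H (Φ t))), pairing_add_right, pairing_smul_right]
  simp
  ring

/-- The mass is the pairing with the identity, which commutes with every `H t`. -/
theorem mass_eq_of_schroedinger {n : ℕ} {ħ : ℝ} (hħ : ħ ≠ 0)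
    {H : ℝ → State n →L[ℂ] State n} (hH : ∀ t, IsSymmetricOp (H t)) {Φ : ℝ → State n}
    (hΦ : Differentiable ℝ Φ)
    (hS : ∀ t, (-(Complex.I * (ħ : ℂ))) • deriv Φ t + H t (Φ t) = 0) (t s : ℝ) :
    mass (Φ t) = mass (Φ s) := by
  have h : ∀ t, HasDerivAt (fun τ => pairing (Φ τ) (Φ τ)) 0 t := fun t => by
    have h1 := hasDerivAt_pairing_of_schroedinger hħ (hH t) (hΦ t).hasDerivAt_curve (hS t) 1
    refine h1.congr_deriv ?_
    simp [heisenberg, pairing]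
  have h2 := is_const_of_deriv_eq_zero (fun t => (h t).differentiableAt) (fun t => (h t).deriv) t s
  simpa only [pairing_self, Complex.ofReal_inj] using h2

theorem hasDerivAt_expectation {n : ℕ} {ħ : ℝ} (hħ : ħ ≠ 0)
    {H : State n →L[ℂ] State n} (hH : IsSymmetricOp H) {Φ : ℝ → State n} {Φ' : State n} {t : ℝ}
    (hΦ : HasDerivAt Φ Φ' t) (hS : (-(Complex.I * (ħ : ℂ))) • Φ' + H (Φ t) = 0)
    (hm : ∀ τ, mass (Φ τ) = mass (Φ t)) (A : State n →L[ℂ] State n) :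
    HasDerivAt (fun τ => expectation A (Φ τ)) (expectation (heisenberg ħ H A) (Φ t)) t := by
  have h := hasDerivAt_pairing_of_schroedinger hħ hH hΦ hS A
  have h1 := (Complex.reCLM.hasFDerivAt.comp_hasDerivAt t h).div_const (mass (Φ t))
  simpa only [expectation_eq, hm, Function.comp_def, Complex.reCLM_apply] using h1

theorem moments_Δ_apply {n : ℕ} (ħ : ℝ) {ψ : State n} (h : mass ψ ≠ 0) (k l : PhaseIdx n) :
    (moments ħ ψ).Δ k l = expectation (symProd (zOp ħ k) (zOp ħ l)) ψ -
      firstMoments ħ ψ k * firstMoments ħ ψ l := by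
  set a := firstMoments ħ ψ with ha
  have h1 : (1 / 2 : ℂ) • (centeredOp ħ a k ∘L centeredOp ħ a l +
      centeredOp ħ a l ∘L centeredOp ħ a k) =
      symProd (zOp ħ k) (zOp ħ l) + ((-a k : ℝ) : ℂ) • zOp ħ l + ((-a l : ℝ) : ℂ) • zOp ħ k +
        ((a k * a l : ℝ) : ℂ) • (1 : State n →L[ℂ] State n) := by
    have h2 : ∀ k, centeredOp (n := n) ħ a k = zOp ħ k + ((-a k : ℝ) : ℂ) • 1 := fun k => by
      rw [centeredOp, Complex.ofReal_neg, neg_smul, ← sub_eq_add_neg]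
      rfl
    simp only [← ContinuousLinearMap.mul_def, h2, symProd, add_mul, mul_add, smul_mul_assoc,
      mul_smul_comm, one_mul, mul_one, smul_add]
    push_cast
    module
  change expectation ((1 / 2 : ℂ) • (centeredOp ħ a k ∘L centeredOp ħ a l +
      centeredOp ħ a l ∘L centeredOp ħ a k)) ψ = _
  rw [h1, expectation_add, expectation_add, expectation_add, expectation_smul, expectation_smul,
    expectation_smul, expectation_one h]
  change _ + -a k * firstMoments ħ ψ l + -a l * firstMoments ħ ψ k + _ = _
  rw [← ha]
  ring

theorem moments_Δ_isSymm {n : ℕ} (ħ : ℝ) (ψ : State n) : (moments ħ ψ).Δ.IsSymm := by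
  ext k l
  change expectation _ ψ = expectation _ ψ
  rw [add_comm]

/-! ### Evolution of the moments under the associated linear equation -/

theorem quadOp_add {n : ℕ} (ħ : ℝ) (M M' : Matrix (PhaseIdx n) (PhaseIdx n) ℝ) :
    quadOp ħ (M + M') = quadOp ħ M + quadOp ħ M' := by
  simp [quadOp, add_smul, Finset.sum_add_distrib]

theorem quadOp_smul {n : ℕ} (ħ c : ℝ) (M : Matrix (PhaseIdx n) (PhaseIdx n) ℝ) :
    quadOp ħ (c • M) = (c : ℂ) • quadOp ħ M := by
  simp only [quadOp, Finset.smul_sum, smul_smul, Matrix.smul_apply, smul_eq_mul, Complex.ofReal_mul]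

theorem linOp_add {n : ℕ} (ħ : ℝ) (v v' : PhaseIdx n → ℝ) :
    linOp ħ (v + v') = linOp ħ v + linOp ħ v' := by
  simp [linOp, add_smul, Finset.sum_add_distrib]

theorem linOp_smul {n : ℕ} (ħ c : ℝ) (v : PhaseIdx n → ℝ) :
    linOp ħ (c • v) = (c : ℂ) • linOp ħ v := by
  simp only [linOp, Finset.smul_sum, smul_smul, Pi.smul_apply, smul_eq_mul, Complex.ofReal_mul]

theorem Hq_eq {n : ℕ} (P : Coeffs n) (κt t : ℝ) (m : Moments n) :
    Hq P κt t m = (1 / 2 : ℂ) • quadOp P.ħ (P.Hzz t + κt • P.Wzz t) +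
      linOp P.ħ (P.Hz t + κt • (P.Wzw t *ᵥ m.z)) +
      ((κt / 2 * (m.z ⬝ᵥ (P.Www t *ᵥ m.z)) + κt / 2 * (P.Www t * m.Δ).trace : ℝ) : ℂ) • 1 := by
  rw [quadOp_add, quadOp_smul, linOp_add, linOp_smul, Hq, smul_add, smul_smul,
    show ((κt / 2 : ℝ) : ℂ) = 1 / 2 * (κt : ℂ) by push_cast; ring, ContinuousLinearMap.one_def]
  abel

/-- The prescribed orbit `m` enters only through the `W_zw` forcing; elsewhere the moments are those
of `Φ`. The two need not agree here. -/
theorem hasDerivAt_moments_z {n : ℕ} (P : Coeffs n) (κt : ℝ) (m : ℝ → Moments n)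
    {Φ : ℝ → State n} {t : ℝ} (hΦ : DifferentiableAt ℝ Φ t) (hL : L P κt m Φ t = 0)
    (hm : ∀ τ, mass (Φ τ) = mass (Φ t)) (h0 : mass (Φ t) ≠ 0) (k : PhaseIdx n) :
    HasDerivAt (fun τ => (moments P.ħ (Φ τ)).z k)
      (((Matrix.J (Fin n) ℝ * (P.Hzz t + κt • P.Wzz t)) *ᵥ (moments P.ħ (Φ t)).z +
        Matrix.J (Fin n) ℝ *ᵥ (P.Hz t + κt • (P.Wzw t *ᵥ (m t).z))) k) t := by
  have h := hasDerivAt_expectation P.ħ_pos.ne' (isSymmetricOp_Hq P κt t (m t)) hΦ.hasDerivAt_curve hL hm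
    (zOp P.ħ k)
  refine h.congr_deriv ?_
  rw [Hq_eq, heisenberg_zOp P.ħ_pos.ne' ((P.Hzz_symm t).add ((P.Wzz_symm t).smul κt)),
    expectation_add, expectation_linOp, expectation_smul, expectation_one h0, mul_one]
  rfl

/-- The uncentered second moments also feel the linear force `b`, but centering cancels it. The
equation for `Δ` is therefore independent of `m`. -/
theorem hasDerivAt_moments_Δ {n : ℕ} (P : Coeffs n) (κt : ℝ) (m : ℝ → Moments n)
    {Φ : ℝ → State n} {t : ℝ} (hΦ : DifferentiableAt ℝ Φ t) (hL : L P κt m Φ t = 0)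
    (hm : ∀ τ, mass (Φ τ) = mass (Φ t)) (h0 : mass (Φ t) ≠ 0) (k l : PhaseIdx n) :
    HasDerivAt (fun τ => (moments P.ħ (Φ τ)).Δ k l)
      ((Matrix.J (Fin n) ℝ * (P.Hzz t + κt • P.Wzz t) * (moments P.ħ (Φ t)).Δ
        - (moments P.ħ (Φ t)).Δ * (P.Hzz t + κt • P.Wzz t) * Matrix.J (Fin n) ℝ) k l) t := by
  have hM : (P.Hzz t + κt • P.Wzz t).IsSymm := (P.Hzz_symm t).add ((P.Wzz_symm t).smul κt)
  set M := P.Hzz t + κt • P.Wzz t with hMdef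
  set b := P.Hz t + κt • (P.Wzw t *ᵥ (m t).z) with hb
  have hH := isSymmetricOp_Hq P κt t (m t)
  have hσ := hasDerivAt_expectation P.ħ_pos.ne' hH hΦ.hasDerivAt_curve hL hm
    (symProd (zOp P.ħ k) (zOp P.ħ l))
  have hz := hasDerivAt_moments_z P κt m hΦ hL hm h0
  have hfun : (fun τ => (moments P.ħ (Φ τ)).Δ k l) = fun τ =>
      expectation (symProd (zOp P.ħ k) (zOp P.ħ l)) (Φ τ) -
        (moments P.ħ (Φ τ)).z k * (moments P.ħ (Φ τ)).z l := by
    ext τ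
    exact moments_Δ_apply P.ħ (by rwa [hm τ]) k l
  rw [hfun]
  refine (hσ.sub ((hz k).mul (hz l))).congr_deriv ?_
  -- With `A = J M`, the right-hand side becomes `A Δ + Δ Aᵀ`.
  have hJ : M * Matrix.J (Fin n) ℝ = -(Matrix.J (Fin n) ℝ * M)ᵀ := by
    rw [Matrix.transpose_mul, Matrix.J_transpose, hM.eq]
    simp
  rw [Hq_eq, ← hMdef, ← hb, heisenberg_symProd, heisenberg_zOp P.ħ_pos.ne' hM,
    heisenberg_zOp P.ħ_pos.ne' hM, symProd_comm (zOp P.ħ k), symProd_add_left, symProd_add_left,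
    symProd_smul_left, symProd_smul_left, symProd_one_left, symProd_one_left, symProd_linOp_left,
    symProd_linOp_left, expectation_add, expectation_add, expectation_add, expectation_smul,
    expectation_smul, expectation_sum, expectation_sum, Matrix.mul_assoc (moments P.ħ (Φ t)).Δ M, hJ]
  simp only [expectation_smul]
  have hs : ∀ i j, expectation (symProd (zOp P.ħ i) (zOp P.ħ j)) (Φ t) =
      (moments P.ħ (Φ t)).Δ i j + (moments P.ħ (Φ t)).z i * (moments P.ħ (Φ t)).z j := by
    intro i j
    rw [moments_Δ_apply P.ħ h0]
    simp [moments]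
  have hΔ := fun i j => (moments_Δ_isSymm P.ħ (Φ t)).apply i j
  simp only [hs]
  change _ + _ * (moments P.ħ (Φ t)).z l + (_ + _ * (moments P.ħ (Φ t)).z k) - _ = _
  set z := (moments P.ħ (Φ t)).z
  set Δ := (moments P.ħ (Φ t)).Δ
  set A := Matrix.J (Fin n) ℝ * M
  set d := Matrix.J (Fin n) ℝ *ᵥ b
  simp only [Matrix.row_apply, Matrix.sub_apply, Matrix.mul_neg, Matrix.neg_apply, sub_neg_eq_add,
    Matrix.mul_apply (M := A), Matrix.mul_apply (M := Δ), Matrix.transpose_apply, Pi.add_apply,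
    Matrix.mulVec, dotProduct, mul_add, Finset.sum_add_distrib, ← mul_assoc, ← Finset.sum_mul]
  have e : ∑ x, A l x * Δ x k = ∑ x, Δ k x * A l x :=
    Finset.sum_congr rfl fun x _ => by rw [hΔ x k, mul_comm]
  rw [e]
  ring


/-! ### The RGPE as a linear equation along its own moments -/

theorem pairing_sum_right {n : ℕ} {ι : Type*} (S : Finset ι) (φ : State n) (F : ι → State n) :
    pairing φ (∑ i ∈ S, F i) = ∑ i ∈ S, pairing φ (F i) := by
  simp only [pairing_eq_inner, map_sum, inner_sum]

theorem expectation_quadOp {n : ℕ} (ħ : ℝ) {M : Matrix (PhaseIdx n) (PhaseIdx n) ℝ}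
    (hM : M.IsSymm) {ψ : State n} (h : mass ψ ≠ 0) :
    expectation (quadOp ħ M) ψ = (moments ħ ψ).z ⬝ᵥ (M *ᵥ (moments ħ ψ).z) +
      (M * (moments ħ ψ).Δ).trace := by
  have hs : ∀ k l, expectation (symProd (zOp ħ k) (zOp ħ l)) ψ =
      (moments ħ ψ).Δ l k + (moments ħ ψ).z k * (moments ħ ψ).z l := fun k l => by
    rw [(moments_Δ_isSymm ħ ψ).apply, moments_Δ_apply ħ h]
    simp [moments]
  rw [quadOp_eq_sum_symProd ħ hM]
  simp only [expectation_sum, expectation_smul, hs, Matrix.trace, Matrix.diag_apply,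
    Matrix.mul_apply, Matrix.mulVec, dotProduct, mul_add, Finset.sum_add_distrib, Finset.mul_sum]
  rw [add_comm]
  congr 1
  refine Finset.sum_congr rfl fun k _ => Finset.sum_congr rfl fun l _ => ?_
  ring

theorem integral_conj_mul_Vqu {n : ℕ} (P : Coeffs n) (t : ℝ) (φ : State n)
    (x : EuclideanSpace ℝ (Fin n)) :
    ∫ y, conj (φ y) * Vqu P t φ φ x y =
      (1 / 2 : ℂ) * quadOp P.ħ (P.Wzz t) φ x * pairing φ φ +
        ∑ k, ∑ l, ((P.Wzw t k l : ℝ) : ℂ) * zOp P.ħ k φ x * pairing φ (zOp P.ħ l φ) +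
        (1 / 2 : ℂ) * φ x * pairing φ (quadOp P.ħ (P.Www t) φ) := by
  have h : ∀ y, Vqu P t φ φ x y = (((1 / 2 : ℂ) * quadOp P.ħ (P.Wzz t) φ x) • φ +
      ∑ k, ∑ l, (((P.Wzw t k l : ℝ) : ℂ) * zOp P.ħ k φ x) • zOp P.ħ l φ +
      ((1 / 2 : ℂ) * φ x) • quadOp P.ħ (P.Www t) φ) y := by
    intro y
    simp only [Vqu, add_apply, smul_apply, sum_apply, smul_eq_mul, mul_assoc]
  simp only [h]
  rw [← pairing, pairing_add_right, pairing_add_right, pairing_smul_right, pairing_smul_right]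
  simp only [pairing_sum_right, pairing_smul_right]

/-- On `φ`, the nonlinear operator of the reduced Gross--Pitaevskii equation is the operator of the
associated linear equation that belongs to the mass and the moments of `φ`. -/
theorem Hqu_add_integral_Vqu {n : ℕ} (P : Coeffs n) (t : ℝ) (φ : State n)
    (x : EuclideanSpace ℝ (Fin n)) :
    Hqu P t φ x + (P.κ : ℂ) * ∫ y, conj (φ y) * Vqu P t φ φ x y =
      Hq P (P.κ * mass φ) t (moments P.ħ φ) φ x := by
  rcases eq_or_ne (mass φ) 0 with h | h
  · rw [eq_zero_of_mass_eq_zero h]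
    simp
  · have hl : linOp P.ħ (P.Wzw t *ᵥ (moments P.ħ φ).z) φ x =
        ∑ k, ∑ l, ((P.Wzw t k l : ℝ) : ℂ) * zOp P.ħ k φ x * ((expectation (zOp P.ħ l) φ : ℝ) : ℂ) := by
      simp only [linOp, sum_apply, smul_apply, smul_eq_mul, Matrix.mulVec, dotProduct]
      refine Finset.sum_congr rfl fun k _ => ?_
      push_cast
      rw [Finset.sum_mul]
      refine Finset.sum_congr rfl fun l _ => ?_
      rw [mul_right_comm]
      rfl
    rw [integral_conj_mul_Vqu, pairing_self,
      pairing_eq_of_isSymmetricOp (isSymmetricOp_quadOp _ (P.Www_symm t)),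
      expectation_quadOp P.ħ (P.Www_symm t) h]
    simp only [pairing_eq_of_isSymmetricOp (isSymmetricOp_zOp _ _), Hq, add_apply, smul_apply,
      smul_eq_mul, hl, ContinuousLinearMap.id_apply, Hqu]
    have hs : ∑ k, ∑ l, ((P.Wzw t k l : ℝ) : ℂ) * zOp P.ħ k φ x *
        ((mass φ * expectation (zOp P.ħ l) φ : ℝ) : ℂ) = (mass φ : ℂ) *
        ∑ k, ∑ l, ((P.Wzw t k l : ℝ) : ℂ) * zOp P.ħ k φ x *
          ((expectation (zOp P.ħ l) φ : ℝ) : ℂ) := by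
      simp only [Finset.mul_sum]
      refine Finset.sum_congr rfl fun k _ => Finset.sum_congr rfl fun l _ => ?_
      push_cast
      ring
    rw [hs]
    push_cast
    ring

/-- The parameter is the mass at time `t`, since its conservation is only deduced from this form. -/
theorem isSolution_iff {n : ℕ} (P : Coeffs n) (Ψ : ℝ → State n) :
    IsSolution P Ψ ↔ IsSmoothCurve Ψ ∧
      ∀ t, L P (P.κ * mass (Ψ t)) (fun τ => moments P.ħ (Ψ τ)) Ψ t = 0 := by
  refine and_congr_right fun _ => forall_congr' fun t => ?_
  rw [SchwartzMap.ext_iff]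
  refine forall_congr' fun x => ?_
  rw [add_assoc, Hqu_add_integral_Vqu]
  rfl


/-! ### Uniqueness for linear ODEs and the Hamilton–Ehrenfest system -/

/-- Continuous coefficients are bounded on a compact interval around `s` and `t`, which gives a
uniform Lipschitz constant there. -/
theorem linear_ode_unique {E : Type*} [NormedAddCommGroup E] [NormedSpace ℝ E]
    [FiniteDimensional ℝ E] {A : ℝ → E →ₗ[ℝ] E} (hA : ∀ y, Continuous fun t => A t y) {b : ℝ → E}
    {f f' : ℝ → E} (hf : ∀ t, HasDerivAt f (A t (f t) + b t) t)
    (hf' : ∀ t, HasDerivAt f' (A t (f' t) + b t) t) {s : ℝ} (hs : f s = f' s) : f = f' := by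
  have hc : Continuous fun t => LinearMap.toContinuousLinearMap (A t) :=
    continuous_clm_apply.2 hA
  ext t
  obtain ⟨a, c, ht, hs'⟩ : ∃ a c, t ∈ Set.Ioo a c ∧ s ∈ Set.Ioo a c :=
    ⟨min t s - 1, max t s + 1, by grind, by grind⟩
  obtain ⟨K, hK⟩ := (isCompact_Icc (a := a) (b := c)).exists_bound_of_continuousOn hc.continuousOn
  refine ODE_solution_unique_of_mem_Ioo (v := fun t y => A t y + b t) (s := fun _ => Set.univ)
    (K := K.toNNReal) (fun τ hτ => ?_) hs' (fun τ _ => ⟨hf τ, trivial⟩)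
    (fun τ _ => ⟨hf' τ, trivial⟩) hs ht
  refine LipschitzOnWith.of_dist_le_mul fun y _ y' _ => ?_
  rw [dist_add_right, dist_eq_norm, dist_eq_norm, ← map_sub]
  exact (ContinuousLinearMap.le_opNorm (LinearMap.toContinuousLinearMap (A τ)) (y - y')).trans
    (mul_le_mul_of_nonneg_right ((hK τ (Set.Ioo_subset_Icc_self hτ)).trans (Real.le_coe_toNNReal K))
      (norm_nonneg _))

theorem mulVec_ode_unique {ι : Type*} [Fintype ι] {X : ℝ → Matrix ι ι ℝ} (hX : Continuous X)
    {b f f' : ℝ → ι → ℝ} (hf : ∀ t k, HasDerivAt (fun τ => f τ k) ((X t *ᵥ f t + b t) k) t)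
    (hf' : ∀ t k, HasDerivAt (fun τ => f' τ k) ((X t *ᵥ f' t + b t) k) t) {s : ℝ}
    (hs : f s = f' s) : f = f' :=
  linear_ode_unique (A := fun t => (X t).mulVecLin) (b := b)
    (fun _ => hX.matrix_mulVec continuous_const) (fun t => hasDerivAt_pi.2 (hf t))
    (fun t => hasDerivAt_pi.2 (hf' t)) hs

theorem matrix_ode_unique {ι : Type*} [Fintype ι] {X Y : ℝ → Matrix ι ι ℝ} (hX : Continuous X)
    (hY : Continuous Y) {F F' : ℝ → Matrix ι ι ℝ}
    (hF : ∀ t k l, HasDerivAt (fun τ => F τ k l) ((X t * F t - F t * Y t) k l) t)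
    (hF' : ∀ t k l, HasDerivAt (fun τ => F' τ k l) ((X t * F' t - F' t * Y t) k l) t) {s : ℝ}
    (hs : F s = F' s) : F = F' := by
  let A : ℝ → (ι → ι → ℝ) →ₗ[ℝ] (ι → ι → ℝ) := fun t =>
    (Matrix.ofLinearEquiv ℝ).symm.toLinearMap ∘ₗ
      (LinearMap.mulLeft ℝ (X t) - LinearMap.mulRight ℝ (Y t)) ∘ₗ
        (Matrix.ofLinearEquiv ℝ).toLinearMap
  have hA : ∀ y, Continuous fun t => A t y := fun y =>
    (hX.matrix_mul continuous_const).sub (continuous_const.matrix_mul hY)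
  exact linear_ode_unique (E := ι → ι → ℝ) (A := A) (b := 0) hA
    (fun t => hasDerivAt_pi.2 fun k => hasDerivAt_pi.2 fun l =>
      (hF t k l).congr_deriv (add_zero _).symm)
    (fun t => hasDerivAt_pi.2 fun k => hasDerivAt_pi.2 fun l =>
      (hF' t k l).congr_deriv (add_zero _).symm) hs

theorem continuous_J_mul {n : ℕ} {M : ℝ → Matrix (PhaseIdx n) (PhaseIdx n) ℝ} (hM : Continuous M) :
    Continuous fun t => Matrix.J (Fin n) ℝ * M t :=
  continuous_const.matrix_mul hM

theorem continuous_mul_J {n : ℕ} {M : ℝ → Matrix (PhaseIdx n) (PhaseIdx n) ℝ} (hM : Continuous M) :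
    Continuous fun t => M t * Matrix.J (Fin n) ℝ :=
  hM.matrix_mul continuous_const

theorem continuous_Hzz_add_Wzz {n : ℕ} (P : Coeffs n) (κt : ℝ) :
    Continuous fun t => P.Hzz t + κt • P.Wzz t :=
  P.Hzz_cont.add (P.Wzz_cont.const_smul κt)

theorem IsHESSolution.unique {n : ℕ} {P : Coeffs n} {κt : ℝ} {m m' : ℝ → Moments n}
    (hm : IsHESSolution P κt m) (hm' : IsHESSolution P κt m') {s : ℝ} (hs : m s = m' s) :
    m = m' := by
  have hz : (fun t => (m t).z) = fun t => (m' t).z := by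
    have hX : Continuous fun t => Matrix.J (Fin n) ℝ * (P.Hzz t + κt • (P.Wzz t + P.Wzw t)) :=
      continuous_J_mul (P.Hzz_cont.add ((P.Wzz_cont.add P.Wzw_cont).const_smul κt))
    refine mulVec_ode_unique hX (b := fun t => Matrix.J (Fin n) ℝ *ᵥ P.Hz t) (s := s)
      (fun t k => ((hm t).2.1 k).congr_deriv ?_) (fun t k => ((hm' t).2.1 k).congr_deriv ?_)
      (by rw [hs])
    all_goals rw [Matrix.mulVec_add, Matrix.mulVec_mulVec, add_comm]
  have hΔ : (fun t => (m t).Δ) = fun t => (m' t).Δ := by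
    have hc := continuous_Hzz_add_Wzz P κt
    refine matrix_ode_unique (continuous_J_mul hc) (continuous_mul_J hc) (s := s)
      (fun t k l => ((hm t).2.2 k l).congr_deriv ?_) (fun t k l => ((hm' t).2.2 k l).congr_deriv ?_)
      (by rw [hs])
    all_goals rw [Matrix.mul_assoc _ _ (Matrix.J (Fin n) ℝ)]
  ext1 t
  exact Moments.ext (congrFun hz t) (congrFun hΔ t)

/-! ### Self-consistency of mass and moments -/

/-- A time-dependent `κt` is allowed so that the lemma applies to an RGPE solution before its mass
is known to be constant. -/
theorem mass_eq_of_L_eq_zero {n : ℕ} {P : Coeffs n} {κt : ℝ → ℝ} {m : ℝ → Moments n}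
    {Φ : ℝ → State n} (hΦ : IsSmoothCurve Φ) (hL : ∀ t, L P (κt t) m Φ t = 0) (t s : ℝ) :
    mass (Φ t) = mass (Φ s) :=
  mass_eq_of_schroedinger P.ħ_pos.ne' (fun t => isSymmetricOp_Hq P (κt t) t (m t)) (hΦ 0) hL t s

theorem J_mulVec_orbit {n : ℕ} (P : Coeffs n) (κt t : ℝ) (z : PhaseIdx n → ℝ) :
    (Matrix.J (Fin n) ℝ * (P.Hzz t + κt • P.Wzz t)) *ᵥ z +
        Matrix.J (Fin n) ℝ *ᵥ (P.Hz t + κt • (P.Wzw t *ᵥ z)) =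
      Matrix.J (Fin n) ℝ *ᵥ (P.Hz t + (P.Hzz t + κt • (P.Wzz t + P.Wzw t)) *ᵥ z) := by
  rw [← Matrix.mulVec_mulVec, ← Matrix.mulVec_add]
  congr 1
  simp only [smul_add, Matrix.add_mulVec, Matrix.smul_mulVec]
  abel

/-- The Hamilton--Ehrenfest system is satisfied by the moments of a curve that solves the linear
equation associated with its own moments. -/
theorem isHESSolution_moments {n : ℕ} {P : Coeffs n} {κt : ℝ} {Φ : ℝ → State n}
    (hΦ : IsSmoothCurve Φ) (hL : ∀ t, L P κt (fun τ => moments P.ħ (Φ τ)) Φ t = 0)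
    (h0 : ∀ t, mass (Φ t) ≠ 0) : IsHESSolution P κt fun t => moments P.ħ (Φ t) := by
  have hd : Differentiable ℝ Φ := hΦ 0
  intro t
  have hm := fun τ => mass_eq_of_L_eq_zero (κt := fun _ => κt) hΦ hL τ t
  refine ⟨moments_Δ_isSymm _ _, fun k => ?_, hasDerivAt_moments_Δ P κt _ (hd t) (hL t) hm (h0 t)⟩
  refine (hasDerivAt_moments_z P κt _ (hd t) (hL t) hm (h0 t) k).congr_deriv ?_
  exact congrFun (J_mulVec_orbit P κt t _) k

/-- A solution of the linear equation associated with the phase orbit `m` has the moments `m` at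
all times if it has them at the initial time. -/
theorem moments_eq_of_L_eq_zero {n : ℕ} {P : Coeffs n} {κt : ℝ} {m : ℝ → Moments n}
    (hm : IsHESSolution P κt m) {Φ : ℝ → State n} (hΦ : IsSmoothCurve Φ)
    (hL : ∀ t, L P κt m Φ t = 0) (h0 : ∀ t, mass (Φ t) ≠ 0) {s : ℝ}
    (hs : moments P.ħ (Φ s) = m s) (t : ℝ) : moments P.ħ (Φ t) = m t := by
  have hd : Differentiable ℝ Φ := hΦ 0
  have hmass := fun τ t => mass_eq_of_L_eq_zero (κt := fun _ => κt) hΦ hL τ t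
  have hc := continuous_Hzz_add_Wzz P κt
  have hz : (fun t => (moments P.ħ (Φ t)).z) = fun t => (m t).z := by
    -- The first moments of `Φ` and the orbit solve the same affine ODE, the `W_zw` term of the
    -- orbit being treated as given forcing.
    refine mulVec_ode_unique (continuous_J_mul hc) (s := s)
      (fun t k => hasDerivAt_moments_z P κt m (hd t) (hL t) (fun τ => hmass τ t) (h0 t) k)
      (fun t k => ((hm t).2.1 k).congr_deriv ?_) (by rw [hs])
    exact (congrFun (J_mulVec_orbit P κt t _) k).symm
  have hΔ : (fun t => (moments P.ħ (Φ t)).Δ) = fun t => (m t).Δ := by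
    refine matrix_ode_unique (continuous_J_mul hc) (continuous_mul_J hc) (s := s)
      (fun t k l => (hasDerivAt_moments_Δ P κt m (hd t) (hL t) (fun τ => hmass τ t) (h0 t)
        k l).congr_deriv ?_) (fun t k l => ((hm t).2.2 k l).congr_deriv ?_) (by rw [hs])
    all_goals rw [Matrix.mul_assoc _ _ (Matrix.J (Fin n) ℝ)]
  exact Moments.ext (congrFun hz t) (congrFun hΔ t)

theorem Intertwines.L_eq_zero {n : ℕ} {P : Coeffs n} {κt' κt : ℝ} {m' m : ℝ → Moments n}
    {T : ℝ → (State n →ₗ[ℂ] State n)} (hT : Intertwines P κt' m' κt m T) {Φ : ℝ → State n}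
    (hΦ : IsSmoothCurve Φ) (hL : ∀ t, L P κt m Φ t = 0) (t : ℝ) :
    L P κt' m' (fun τ => T τ (Φ τ)) t = 0 := by
  rw [(hT Φ hΦ).2 t, hL t, map_zero]

theorem constants_spec {n : ℕ} {𝒞 : Type*} [Nonempty 𝒞] {g : ℝ → 𝒞 → Moments n} {t : ℝ}
    {m : Moments n} (h : ∃ C, g t C = m) : g t (constants g t m) = m :=
  Classical.epsilon_spec h

end RGPE

/-! ### The nonlinear symmetry operator -/

theorem theorem1 {n : ℕ} (P : RGPE.Coeffs n) (s : ℝ) (N N' : ℝ) (hN : 0 < N) (hN' : 0 < N')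
    {𝒞 : Type*} [Nonempty 𝒞] (g : ℝ → ℝ → 𝒞 → RGPE.Moments n)
    (hg : RGPE.IsGeneralSolution P (P.κ * N) s (g (P.κ * N)))
    (hg' : RGPE.IsGeneralSolution P (P.κ * N') s (g (P.κ * N')))
    (D : ℝ → 𝒞 → 𝒞 → (RGPE.State n →ₗ[ℂ] RGPE.State n))
    (hD : ∀ C' C : 𝒞, RGPE.IsFundamentalIntertwining P s
      (P.κ * N') (fun t => g (P.κ * N') t C') (P.κ * N) (fun t => g (P.κ * N) t C)
      (fun t => D t C' C))
    (a : 𝒞 → (RGPE.State n →ₗ[ℂ] RGPE.State n))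
    (B : ℝ → 𝒞 → (RGPE.State n →ₗ[ℂ] RGPE.State n))
    (hB : ∀ C : 𝒞, RGPE.IsLinearSymmetry P s (P.κ * N) (fun t => g (P.κ * N) t C) (a C)
      (fun t => B t C))
    (Ψ : ℝ → RGPE.State n) (hΨ : RGPE.IsSolution P Ψ) (hmass : RGPE.mass (Ψ s) = N)
    (hmass' : RGPE.mass (RGPE.initialImage P s (g (P.κ * N)) a Ψ) = N') :
    (∀ t, ∃! C, g (P.κ * N) t C = RGPE.moments P.ħ (Ψ t)) ∧
    (∀ t, RGPE.constantsOf P (g (P.κ * N)) Ψ t = RGPE.constantsOf P (g (P.κ * N)) Ψ s) ∧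
    (∃! C', g (P.κ * N') s C' =
      RGPE.moments P.ħ (RGPE.initialImage P s (g (P.κ * N)) a Ψ)) ∧
    RGPE.IsSolution P
      (RGPE.nonlinearSymmetry P s (g (P.κ * N')) (g (P.κ * N)) D a B Ψ) ∧
    RGPE.nonlinearSymmetry P s (g (P.κ * N')) (g (P.κ * N)) D a B Ψ s =
      RGPE.initialImage P s (g (P.κ * N)) a Ψ := by
  obtain ⟨hΨs, hΨL⟩ := (RGPE.isSolution_iff P Ψ).1 hΨ
  have hmassΨ : ∀ t, RGPE.mass (Ψ t) = N := fun t =>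
    (RGPE.mass_eq_of_L_eq_zero (κt := fun t => P.κ * RGPE.mass (Ψ t)) hΨs hΨL t s).trans hmass
  simp only [hmassΨ] at hΨL
  have hHES := RGPE.isHESSolution_moments hΨs hΨL fun t => by rw [hmassΨ t]; exact hN.ne'
  obtain ⟨C₀, hC₀, -⟩ := hg.2 _ (RGPE.moments_Δ_isSymm P.ħ (Ψ s))
  have horbit : (fun t => g (P.κ * N) t C₀) = fun t => RGPE.moments P.ħ (Ψ t) :=
    (hg.1 C₀).unique hHES hC₀
  have huniq : ∀ t C, g (P.κ * N) t C = RGPE.moments P.ħ (Ψ t) → C = C₀ := by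
    intro t C hC
    -- Orbits meeting at time `t` coincide, hence agree at `s`, where the constants are determined
    -- by the Cauchy datum.
    have h := (hg.1 C).unique (hg.1 C₀) (hC.trans (congrFun horbit t).symm)
    exact (hg.2 _ (hg.1 C₀ s).1).unique (congrFun h s) rfl
  have hconst : ∀ t, RGPE.constantsOf P (g (P.κ * N)) Ψ t = C₀ := fun t =>
    huniq t _ (RGPE.constants_spec ⟨C₀, congrFun horbit t⟩)
  have hex' := hg'.2 _
    (RGPE.moments_Δ_isSymm P.ħ (RGPE.initialImage P s (g (P.κ * N)) a Ψ))
  set C₁ := RGPE.constants (g (P.κ * N')) s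
    (RGPE.moments P.ħ (RGPE.initialImage P s (g (P.κ * N)) a Ψ)) with hC₁
  have hC₁s : g (P.κ * N') s C₁ =
      RGPE.moments P.ħ (RGPE.initialImage P s (g (P.κ * N)) a Ψ) :=
    RGPE.constants_spec hex'.exists
  -- As the constants are conserved, the operators act along `Ψ` with frozen parameters, and the
  -- linear intertwining relations apply.
  have hA : RGPE.nonlinearSymmetry P s (g (P.κ * N')) (g (P.κ * N)) D a B Ψ =
      fun t => D t C₁ C₀ (B t C₀ (Ψ t)) := by
    ext1 t
    rw [RGPE.nonlinearSymmetry, hconst t]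
  have hinit : D s C₁ C₀ (B s C₀ (Ψ s)) = RGPE.initialImage P s (g (P.κ * N)) a Ψ := by
    have h1 : D s C₁ C₀ = LinearMap.id := (hD C₁ C₀).2
    have h2 : B s C₀ = a C₀ := (hB C₀).2
    rw [h1, h2, RGPE.initialImage, hconst s, LinearMap.id_apply]
  refine ⟨fun t => ⟨C₀, congrFun horbit t, huniq t⟩, fun t => (hconst t).trans (hconst s).symm,
    hex', ?_, by rw [hA]; exact hinit⟩
  rw [hA]
  have hBs := ((hB C₀).1 Ψ hΨs).1
  have hDs := ((hD C₁ C₀).1 _ hBs).1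
  have hBL := (hB C₀).1.L_eq_zero hΨs (horbit ▸ hΨL)
  have hDL := (hD C₁ C₀).1.L_eq_zero hBs hBL
  have hm : ∀ t, RGPE.mass (D t C₁ C₀ (B t C₀ (Ψ t))) = N' := fun t =>
    (RGPE.mass_eq_of_L_eq_zero (κt := fun _ => P.κ * N') hDs hDL t s).trans (hinit ▸ hmass')
  -- No norm preservation by `D` or `B` is needed: the image solves a linear equation with symmetric
  -- Hamiltonian, so agreement with the data of `âψ` at `s` propagates.
  have hmom := RGPE.moments_eq_of_L_eq_zero (hg'.1 C₁) hDs hDL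
    (fun t => by rw [hm t]; exact hN'.ne') (s := s) (by rw [hC₁s, ← hinit])
  refine (RGPE.isSolution_iff P _).2 ⟨hDs, fun t => ?_⟩
  rw [hm t, funext hmom]
  exact hDL t
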